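/- Let $k,r>0$, let $\alpha\in\mathbb{C}\setminus\{0\}$, and let $u\in\mathbb{R}^3$ be a unit vector, all non-random. For unit vectors $o_{TX},o_{RX}\in\mathbb{R}^3$ put $$b_{NF}=\tfrac12(3uu^{T}-I_3)\,o_{TX},\quad b_{FF}=(I_3-uu^{T})\,o_{TX},\quad J_{NF}=o_{RX}^{T}b_{NF},\quad J_{FF}=o_{RX}^{T}b_{FF},$$ and let the channel coefficient and the field vector be $$h=\alpha\Big(\Big(\tfrac1{(kr)^3}+\tfrac{j}{(kr)^2}\Big)J_{NF}+\tfrac1{2kr}J_{FF}\Big)\in\mathbb{C},\qquad v=\alpha\Big(\Big(\tfrac1{(kr)^3}+\tfrac{j}{(kr)^2}\Big)b_{NF}+\tfrac1{2kr}b_{FF}\Big)\in\mathbb{C}^3,$$ so that $h=o_{RX}^{T}v$. With $\mathbf v_{Re}=\mathrm{Re}(v)$, $\mathbf v_{Im}=\mathrm{Im}(v)$, $v_{Re}=\|\mathbf v_{Re}\|$, $v_{Im}=\|\mathbf v_{Im}\|$, $\rho=\frac{\mathbf v_{Re}^{T}\mathbf v_{Im}}{v_{Re}v_{Im}}$ and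 $\psi(x)=\frac{1}{2\pi\sqrt{1-x}}\mathbf 1_{[0,1]}(x)$, define, for $z\in\mathbb{C}$, $$f(z\,|\,v)=\frac{1}{v_{Re}v_{Im}\sqrt{1-\rho^2}}\;\psi\!\left(\left\|\begin{pmatrix}1&0\\ \rho&\sqrt{1-\rho^2}\end{pmatrix}^{-1}\begin{pmatrix}\mathrm{Re}(z)/v_{Re}\\ \mathrm{Im}(z)/v_{Im}\end{pmatrix}\right\|^2\right)$$ (for linearly independent $\mathbf v_{Re},\mathbf v_{Im}$, which is the case unless $u^{T}o_{TX}\in\{0,1,-1\}$; the values in these exceptional cases, which have probability zero, and at points where the argument of $\psi$ equals $1$, are immaterial and are fixed by the convention $1/0=0$). Assume that $o_{TX}$ and $o_{RX}$ are random, independent, and uniformly distributed on the unit sphere of $\mathbb{R}^3$. Then: 1. $u^{T}o_{TX}$ is uniformly distributed on $[-1,1]$. 2. $f(z\,|\,v)$ depends on $o_{TX}$ only through $u^{T}o_{TX}$; write $f(z\,|\,u^{T}o_{TX}=x)$ for its value when $u^{T}o_{TX}=x\in[-1,1]$. The function $f(\cdot\,|\,v)$ is a density (with respect to Lebesgue measure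 on $\mathbb{C}\cong\mathbb{R}^2$) of the conditional law of $h$ given $o_{TX}$, for almost every $o_{TX}$, and $f(\cdot\,|\,u^{T}o_{TX}=x)$ is a density of the conditional law of $h$ given $u^{T}o_{TX}=x$, for almost every $x\in[-1,1]$. 3. $h$ has a probability density function $f$ with respect to Lebesgue measure on $\mathbb{C}$, and for almost every $z\in\mathbb{C}$ the function $x\mapsto f(z\,|\,u^{T}o_{TX}=x)$ is integrable on $[-1,1]$ and $$f(z)=\frac12\int_{-1}^{1}f(z\,|\,u^{T}o_{TX}=x)\,dx .$$ -/

import Mathlib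

open MeasureTheory ProbabilityTheory Set

open scoped RealInnerProductSpace

noncomputable section

namespace Dipole

/-- Three-dimensional Euclidean space. -/
abbrev E3 : Type := EuclideanSpace ℝ (Fin 3)

/-- The unit sphere of `ℝ³`. -/
abbrev S2 : Type := Metric.sphere (0 : E3) 1

/-- The uniform distribution on the unit sphere: the normalized surface measure. -/
def uniformSphere : Measure S2 :=
  ((volume : Measure E3).toSphere univ)⁻¹ • (volume : Measure E3).toSphere

/-- Scaled near field `b_NF = ½ (3 u uᵀ - I) o`. -/
def nearField (u o : E3) : E3 := (1 / 2 : ℝ) • ((3 * ⟪u, o⟫) • u - o)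

/-- Scaled far field `b_FF = (I - u uᵀ) o`. -/
def farField (u o : E3) : E3 := o - ⟪u, o⟫ • u

/-- Near-field alignment factor `J_NF = o_RXᵀ b_NF`. -/
def nearAlign (u oT oR : E3) : ℝ := ⟪oR, nearField u oT⟫

/-- Far-field alignment factor `J_FF = o_RXᵀ b_FF`. -/
def farAlign (u oT oR : E3) : ℝ := ⟪oR, farField u oT⟫

/-- The channel coefficient
`h = α ((1/(kr)³ + j/(kr)²) J_NF + 1/(2kr) J_FF)`. -/
def channelCoeff (α : ℂ) (k r : ℝ) (u oT oR : E3) : ℂ :=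
  α * ((1 / ((k * r : ℝ) : ℂ) ^ 3 + Complex.I / ((k * r : ℝ) : ℂ) ^ 2)
        * ((nearAlign u oT oR : ℝ) : ℂ)
      + 1 / (2 * ((k * r : ℝ) : ℂ)) * ((farAlign u oT oR : ℝ) : ℂ))

/-- The complex field vector
`v = α ((1/(kr)³ + j/(kr)²) b_NF + 1/(2kr) b_FF) ∈ ℂ³`. -/
def fieldVector (α : ℂ) (k r : ℝ) (u oT : E3) : Fin 3 → ℂ := fun i =>
  α * ((1 / ((k * r : ℝ) : ℂ) ^ 3 + Complex.I / ((k * r : ℝ) : ℂ) ^ 2)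
        * ((nearField u oT i : ℝ) : ℂ)
      + 1 / (2 * ((k * r : ℝ) : ℂ)) * ((farField u oT i : ℝ) : ℂ))

/-- Real part of a vector in `ℂ³`. -/
def reVec (v : Fin 3 → ℂ) : E3 := WithLp.toLp 2 (fun i => (v i).re)

/-- Imaginary part of a vector in `ℂ³`. -/
def imVec (v : Fin 3 → ℂ) : E3 := WithLp.toLp 2 (fun i => (v i).im)

/-- Correlation coefficient of the real and imaginary part of `v`. -/
def corr (v : Fin 3 → ℂ) : ℝ := ⟪reVec v, imVec v⟫ / (‖reVec v‖ * ‖imVec v‖)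

/-- `ψ(x) = 1 / (2π √(1 - x))` on `[0,1]`, and `0` elsewhere. -/
def circFunc (x : ℝ) : ℝ :=
  indicator (Icc (0 : ℝ) 1) (fun y => 1 / (2 * Real.pi * √(1 - y))) x

/-- The conditional density `f(h | v)` for a field vector `v` with linearly independent real
and imaginary parts:
`(v_Re v_Im √(1-ρ²))⁻¹ ψ(‖[1 0; ρ √(1-ρ²)]⁻¹ [Re h / v_Re, Im h / v_Im]ᵀ‖²)`. -/
def pdfGivenField (v : Fin 3 → ℂ) (h : ℂ) : ℝ :=
  1 / (‖reVec v‖ * ‖imVec v‖ * √(1 - corr v ^ 2)) *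
    circFunc (‖(WithLp.toLp 2
      (Matrix.mulVec (!![1, 0; corr v, √(1 - corr v ^ 2)] : Matrix (Fin 2) (Fin 2) ℝ)⁻¹
        ![h.re / ‖reVec v‖, h.im / ‖imVec v‖]) : EuclideanSpace ℝ (Fin 2))‖ ^ 2)

/-- Some unit vector `o` with `uᵀ o = x` (one exists if `‖u‖ = 1` and `x ∈ [-1,1]`). -/
def someOrientation (u : E3) (x : ℝ) : E3 :=
  Classical.epsilon (fun o : E3 => ‖o‖ = 1 ∧ ⟪u, o⟫ = x)

/-- The conditional density `f(h | uᵀ o_TX = x)`: the value `f(h | v)` at the field vector `v` of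
a transmit orientation with `uᵀ o_TX = x`. -/
def pdfGivenProj (α : ℂ) (k r : ℝ) (u : E3) (x : ℝ) (h : ℂ) : ℝ :=
  pdfGivenField (fieldVector α k r u (someOrientation u x)) h

end Dipole

end

/-! Everything rests on one computation: the projection of the uniform law on the sphere to a plane
has density `circFunc` of the squared norm (`map_uniformSphere_planeCoords`). Projecting once more,
to an axis, gives Archimedes' theorem.

For a fixed transmit orientation `o`, the channel coefficient is the pair of inner products of
`o_RX` with `Re v` and `Im v`. It is thus a linear image of the projection of `o_RX` to the plane
spanned by these two vectors, and Gram-Schmidt with a change of variables yields the elliptic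
density `f(z | v)` (`map_uniformSphere_pair`). With `x = ⟪u, o⟫` one has `v = A x u + B o` for
complex constants `A`, `B`. Hence the Gram matrix of `Re v`, `Im v`, and with it the density,
depends only on `x`, and its determinant is a positive constant times `x² (1 - x²)`, nonzero for
almost every `o`.

Since `o_RX` is independent of `o_TX`, freezing `o_TX` gives the conditional law. It factors through
`x`, so it is also the conditional law given `x`. Tonelli then gives the density of `h` as an
average over the uniform `x`, finite for almost every `z` because its total mass is 1. -/

noncomputable section

namespace Dipole

/-! ### Projection of the uniform law on the sphere to a plane -/

/-- Squared Euclidean norm on the coordinate plane. -/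
def planeSq (q : Fin 2 → ℝ) : ℝ := q 0 ^ 2 + q 1 ^ 2

lemma planeSq_nonneg (q : Fin 2 → ℝ) : 0 ≤ planeSq q := by unfold planeSq; positivity

lemma measurable_planeSq : Measurable planeSq := by unfold planeSq; fun_prop

lemma planeSq_smul (c : ℝ) (q : Fin 2 → ℝ) : planeSq (c • q) = c ^ 2 * planeSq q := by
  simp [planeSq]; ring

/-- The upper cut-off in `circFunc` is automatic: for `x > 1` the square root is 0 by convention,
and so is the quotient. -/
lemma circFunc_of_nonneg {x : ℝ} (hx : 0 ≤ x) :
    circFunc x = 1 / (2 * Real.pi * √(1 - x)) := by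
  unfold circFunc
  by_cases h : x ≤ 1
  · rw [indicator_of_mem (mem_Icc.2 ⟨hx, h⟩)]
  · rw [indicator_of_notMem (fun h' => h h'.2), Real.sqrt_eq_zero_of_nonpos (by linarith)]
    simp

lemma measurable_circFunc : Measurable circFunc := by
  unfold circFunc
  exact Measurable.indicator (by fun_prop) measurableSet_Icc

/-- Substitution `z = √(ρ² - a)`, which trades the height `z` over a point of the plane for the
distance `ρ` to the origin. -/
lemma lintegral_Ioi_sqrt_sq_add {a : ℝ} (ha : 0 ≤ a) (G : ℝ → ENNReal) :
    ∫⁻ z in Ioi 0, G √(z ^ 2 + a) = ∫⁻ ρ in Ioi 0, ENNReal.ofReal (ρ / √(ρ ^ 2 - a)) * G ρ := by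
  have hpos : ∀ ρ ∈ Ioi √a, 0 < ρ ^ 2 - a := by
    intro ρ hρ
    have := Real.lt_sq_of_sqrt_lt hρ
    linarith
  have hpos' : ∀ ρ ∈ Ioi √a, 0 < ρ := fun ρ hρ => (Real.sqrt_nonneg a).trans_lt hρ
  have himg : (fun ρ => √(ρ ^ 2 - a)) '' Ioi √a = Ioi 0 := by
    ext z
    simp only [mem_image, mem_Ioi]
    constructor
    · rintro ⟨ρ, hρ, rfl⟩
      exact Real.sqrt_pos.2 (hpos ρ hρ)
    · intro hz
      refine ⟨√(z ^ 2 + a), Real.sqrt_lt_sqrt ha (by nlinarith), ?_⟩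
      rw [Real.sq_sqrt (by positivity), add_sub_cancel_right, Real.sqrt_sq hz.le]
  have key := lintegral_image_eq_lintegral_abs_deriv_mul (s := Ioi √a)
    (f := fun ρ => √(ρ ^ 2 - a)) (f' := fun ρ => ρ / √(ρ ^ 2 - a)) measurableSet_Ioi
    (fun ρ hρ => by
      have h1 : HasDerivAt (fun ρ : ℝ => ρ ^ 2 - a) (2 * ρ) ρ := by
        simpa using (hasDerivAt_pow 2 ρ).sub_const a
      have h2 := h1.sqrt (hpos ρ hρ).ne'
      rw [mul_div_mul_left _ _ two_ne_zero] at h2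
      exact h2.hasDerivWithinAt)
    (fun x hx y hy hxy => by
      have h1 := (Real.sqrt_inj (hpos x hx).le (hpos y hy).le).1 hxy
      have h2 : x ^ 2 = y ^ 2 := by linarith
      exact (pow_left_inj₀ (hpos' x hx).le (hpos' y hy).le two_ne_zero).1 h2)
    (fun z => G √(z ^ 2 + a))
  rw [himg] at key
  rw [key]
  have h1 : ∫⁻ ρ in Ioi √a, ENNReal.ofReal |ρ / √(ρ ^ 2 - a)| * G √(√(ρ ^ 2 - a) ^ 2 + a)
      = ∫⁻ ρ in Ioi √a, ENNReal.ofReal (ρ / √(ρ ^ 2 - a)) * G ρ := by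
    refine setLIntegral_congr_fun measurableSet_Ioi fun ρ hρ => ?_
    have := hpos' ρ hρ
    rw [Real.sq_sqrt (hpos ρ hρ).le, sub_add_cancel, Real.sqrt_sq this.le, abs_of_nonneg]
    positivity
  rw [h1]
  -- The range extends from `ρ > √a` to `ρ > 0` at no cost: for `ρ² ≤ a` the weight is a division by
  -- `√(ρ² - a) = 0`.
  have hsub : Ioi √a ⊆ Ioi 0 := Ioi_subset_Ioi (Real.sqrt_nonneg a)
  rw [← inter_eq_self_of_subset_left hsub, ← setLIntegral_indicator measurableSet_Ioi]
  refine setLIntegral_congr_fun measurableSet_Ioi fun ρ hρ0 => ?_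
  rw [indicator_apply]
  split_ifs with hρ
  · rfl
  have : ρ ^ 2 ≤ a := by
    rw [mem_Ioi, not_lt] at hρ
    exact (Real.le_sqrt' hρ0).1 hρ
  rw [Real.sqrt_eq_zero_of_nonpos (by linarith)]
  simp

lemma lintegral_eq_two_mul_of_even {G : ℝ → ENNReal} (hG : ∀ z, G (-z) = G z) :
    ∫⁻ z, G z = 2 * ∫⁻ z in Ioi 0, G z := by
  have h1 : ∫⁻ z in Iio 0, G z = ∫⁻ z in Ioi 0, G z := by
    have := (Measure.measurePreserving_neg (volume : Measure ℝ)).setLIntegral_comp_preimage_emb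
      (MeasurableEquiv.neg ℝ).measurableEmbedding G (Ioi 0)
    simpa [hG] using this
  rw [← lintegral_add_compl G measurableSet_Ioi (A := Ioi 0), compl_Ioi,
    setLIntegral_congr Iio_ae_eq_Iic.symm, h1, two_mul]

lemma lintegral_comp_inv_smul_plane {ρ : ℝ} (hρ : 0 < ρ) {H : (Fin 2 → ℝ) → ENNReal}
    (hH : Measurable H) :
    ∫⁻ q, H (ρ⁻¹ • q) = ENNReal.ofReal (ρ ^ 2) * ∫⁻ p, H p := by
  have h := Measure.map_addHaar_smul (volume : Measure (Fin 2 → ℝ)) (inv_ne_zero hρ.ne')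
  rw [← lintegral_map hH (measurable_const_smul _), h, lintegral_smul_measure]
  simp

/-- The part of the unit ball of `ℝ × ℝ²` over which the second component of the normalized
vector lies in `A`. -/
def ballCone (A : Set (Fin 2 → ℝ)) : Set (ℝ × (Fin 2 → ℝ)) :=
  {y | √(y.1 ^ 2 + planeSq y.2) ∈ Ioo 0 1 ∧ (√(y.1 ^ 2 + planeSq y.2))⁻¹ • y.2 ∈ A}

lemma measurableSet_ballCone {A : Set (Fin 2 → ℝ)} (hA : MeasurableSet A) :
    MeasurableSet (ballCone A) := by
  have h1 : Measurable fun y : ℝ × (Fin 2 → ℝ) => √(y.1 ^ 2 + planeSq y.2) := by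
    have := measurable_planeSq
    fun_prop
  exact (h1 measurableSet_Ioo).inter ((h1.inv.smul measurable_snd) hA)

/-- Integrate over the height first, in the variable `ρ` (the norm). The Jacobian `ρ / √(ρ² - |q|²)`
is a function of `p = q / ρ` alone, so after swapping the integrals the scaling `q = ρ p` leaves a
factor `ρ²`. The constant is `2 ∫₀¹ ρ² dρ`, with 2 for the two hemispheres. -/
lemma volume_ballCone {A : Set (Fin 2 → ℝ)} (hA : MeasurableSet A) :
    volume (ballCone A)
      = ENNReal.ofReal (2 / 3) * ∫⁻ p in A, ENNReal.ofReal (1 / √(1 - planeSq p)) := by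
  classical
  have hm := measurable_planeSq
  set H : (Fin 2 → ℝ) → ENNReal := A.indicator fun p => ENNReal.ofReal (1 / √(1 - planeSq p))
    with hH
  have hHm : Measurable H := Measurable.indicator (by fun_prop) hA
  set G : (Fin 2 → ℝ) → ℝ → ENNReal := fun q ρ =>
    (Iio (1 : ℝ)).indicator (fun ρ => A.indicator 1 (ρ⁻¹ • q)) ρ with hG
  have hpt : ∀ q : Fin 2 → ℝ, ∀ ρ ∈ Ioi (0 : ℝ),
      ENNReal.ofReal (ρ / √(ρ ^ 2 - planeSq q)) * G q ρ
        = (Iio (1 : ℝ)).indicator (fun ρ => H (ρ⁻¹ • q)) ρ := by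
    intro q ρ hρ
    have hρ : 0 < ρ := hρ
    simp only [hG, hH, indicator_apply]
    split_ifs with h1 h2
    · rw [planeSq_smul]
      have : 1 - ρ⁻¹ ^ 2 * planeSq q = (ρ ^ 2 - planeSq q) / ρ ^ 2 := by field_simp
      rw [this, Real.sqrt_div' _ (by positivity), Real.sqrt_sq hρ.le, one_div_div]
      simp
    · simp
    · simp
  have hslice : ∀ q, ∫⁻ z, (ballCone A).indicator (1 : ℝ × (Fin 2 → ℝ) → ENNReal) (z, q)
      = 2 * ∫⁻ ρ in Ioi 0, (Iio (1 : ℝ)).indicator (fun ρ => H (ρ⁻¹ • q)) ρ := by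
    intro q
    rw [lintegral_eq_two_mul_of_even (fun z => by simp [ballCone, indicator_apply]),
      ← setLIntegral_congr_fun measurableSet_Ioi (hpt q),
      ← lintegral_Ioi_sqrt_sq_add (planeSq_nonneg q)]
    congr 1
    refine setLIntegral_congr_fun measurableSet_Ioi fun z hz => ?_
    have : 0 < √(z ^ 2 + planeSq q) := Real.sqrt_pos.2 (by
      have := planeSq_nonneg q
      have : 0 < z ^ 2 := pow_pos hz 2
      positivity)
    simp only [hG, ballCone, indicator_apply, mem_ofPred_eq, mem_Ioo, this, true_and, mem_Iio]
    by_cases h1 : √(z ^ 2 + planeSq q) < 1 <;> simp [h1]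
  have hmeas : Measurable (Function.uncurry fun (q : Fin 2 → ℝ) (ρ : ℝ) =>
      (Iio (1 : ℝ)).indicator (fun ρ => H (ρ⁻¹ • q)) ρ) := by
    have : (Function.uncurry fun (q : Fin 2 → ℝ) (ρ : ℝ) =>
      (Iio (1 : ℝ)).indicator (fun ρ => H (ρ⁻¹ • q)) ρ)
        = (Prod.snd ⁻¹' Iio (1 : ℝ)).indicator fun y : (Fin 2 → ℝ) × ℝ => H (y.2⁻¹ • y.1) := by
      ext y
      simp [Function.uncurry, indicator_apply]
    rw [this]
    exact Measurable.indicator (by fun_prop) (measurable_snd measurableSet_Iio)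
  rw [← lintegral_indicator_one (measurableSet_ballCone hA), Measure.volume_eq_prod,
    lintegral_prod_symm _ ((measurable_one.indicator (measurableSet_ballCone hA)).aemeasurable)]
  rw [lintegral_congr hslice]
  rw [lintegral_const_mul' _ _ (by simp), lintegral_lintegral_swap hmeas.aemeasurable]
  have hin : ∀ ρ ∈ Ioi (0 : ℝ), ∫⁻ q, (Iio (1 : ℝ)).indicator (fun ρ => H (ρ⁻¹ • q)) ρ
      = (Iio (1 : ℝ)).indicator (fun ρ => ENNReal.ofReal (ρ ^ 2) * ∫⁻ p, H p) ρ := by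
    intro ρ hρ
    by_cases h : ρ ∈ Iio (1 : ℝ)
    · simp only [indicator_of_mem h]
      exact lintegral_comp_inv_smul_plane hρ hHm
    · simp [indicator_of_notMem h]
  rw [setLIntegral_congr_fun measurableSet_Ioi hin, setLIntegral_indicator measurableSet_Iio,
    lintegral_mul_const _ (by fun_prop), ← mul_assoc, hH, lintegral_indicator hA]
  congr 1
  have hpoly : ∫⁻ ρ in Iio (1 : ℝ) ∩ Ioi 0, ENNReal.ofReal (ρ ^ 2) = ENNReal.ofReal (1 / 3) := by
    rw [← ofReal_integral_eq_lintegral_ofReal]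
    · rw [inter_comm, Ioi_inter_Iio, ← integral_Ioc_eq_integral_Ioo,
        ← intervalIntegral.integral_of_le zero_le_one, integral_pow]
      norm_num
    · rw [inter_comm, Ioi_inter_Iio]
      exact ((continuous_pow 2).integrableOn_Icc (a := (0 : ℝ)) (b := 1)).mono_set Ioo_subset_Icc_self
    · exact Filter.Eventually.of_forall fun ρ => sq_nonneg ρ
  rw [hpoly, show (2 : ENNReal) = ENNReal.ofReal 2 by simp, ← ENNReal.ofReal_mul (by norm_num)]
  norm_num

-- Coordinates in `b`, with `b 0` split off as height, preserve volume and norm, and they carry the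
-- radial cone over a subset of the sphere to `ballCone`.
open scoped Pointwise in
lemma volume_cone_eq_volume_ballCone (b : OrthonormalBasis (Fin 3) ℝ E3) {A : Set (Fin 2 → ℝ)}
    (hA : MeasurableSet A) :
    volume (Ioo (0 : ℝ) 1 • ((↑) '' ((fun o : S2 => ![⟪b 1, (o : E3)⟫, ⟪b 2, (o : E3)⟫]) ⁻¹' A) :
      Set E3)) = volume (ballCone A) := by
  set Φ : E3 → ℝ × (Fin 2 → ℝ) := fun x =>
    MeasurableEquiv.piFinSuccAbove (fun _ : Fin 3 => ℝ) 0 (WithLp.ofLp (b.repr x)) with hΦ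
  have hmp : MeasurePreserving Φ volume volume :=
    (volume_preserving_piFinSuccAbove (fun _ : Fin 3 => ℝ) 0).comp
      ((PiLp.volume_preserving_ofLp (Fin 3)).comp b.measurePreserving_repr)
  have h1 : ∀ x, (Φ x).1 = ⟪b 0, x⟫ := fun x => by
    simp [hΦ, MeasurableEquiv.piFinSuccAbove, b.repr_apply_apply]
  have h2 : ∀ x, (Φ x).2 = ![⟪b 1, x⟫, ⟪b 2, x⟫] := fun x => by
    ext j
    fin_cases j <;> simp [hΦ, MeasurableEquiv.piFinSuccAbove, ← b.repr_apply_apply, Fin.tail]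
  have hn : ∀ x, √((Φ x).1 ^ 2 + planeSq (Φ x).2) = ‖x‖ := fun x => by
    rw [← Real.sqrt_sq (norm_nonneg x), ← b.sum_sq_inner_right x, Fin.sum_univ_three, h1, h2]
    simp [planeSq, add_assoc]
  rw [← hmp.measure_preimage (measurableSet_ballCone hA).nullMeasurableSet]
  congr 1
  ext x
  simp only [ballCone, mem_preimage, mem_ofPred_eq, hn]
  simp only [h2]
  constructor
  · rintro ⟨t, ht, _, ⟨o, ho, rfl⟩, rfl⟩
    have hnorm : ‖t • (o : E3)‖ = t := by
      rw [norm_smul, norm_eq_of_mem_sphere, mul_one, Real.norm_of_nonneg ht.1.le]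
    simp only [hnorm]
    refine ⟨ht, ?_⟩
    rw [mem_preimage] at ho
    convert ho using 1
    ext j
    have := ht.1.ne'
    fin_cases j <;> simp [inner_smul_right] <;> field_simp
  · rintro ⟨ht, hx⟩
    have hmem : ‖x‖⁻¹ • x ∈ Metric.sphere (0 : E3) 1 := by
      rw [mem_sphere_zero_iff_norm, norm_smul, norm_inv, norm_norm, inv_mul_cancel₀ ht.1.ne']
    refine ⟨‖x‖, ht, ‖x‖⁻¹ • x, ⟨⟨‖x‖⁻¹ • x, hmem⟩, ?_, rfl⟩, ?_⟩
    · rw [mem_preimage]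
      convert hx using 1
      ext j
      fin_cases j <;> simp [inner_smul_right]
    · simp [smul_smul, ht.1.ne']

lemma measurable_planeCoords (b : OrthonormalBasis (Fin 3) ℝ E3) :
    Measurable fun o : S2 => ![⟪b 1, (o : E3)⟫, ⟪b 2, (o : E3)⟫] := by
  refine measurable_pi_lambda _ fun j => ?_
  fin_cases j
  · exact Continuous.measurable (by dsimp; fun_prop)
  · exact Continuous.measurable (by dsimp; fun_prop)

/-- Surface measure is 3 times the volume of the radial cone, and its total mass is `4π`. With
`volume_ballCone` the constant becomes `3 · (2/3) / (4π) = 1 / (2π)`, the one in `circFunc`. -/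
theorem map_uniformSphere_planeCoords (b : OrthonormalBasis (Fin 3) ℝ E3) :
    uniformSphere.map (fun o : S2 => ![⟪b 1, (o : E3)⟫, ⟪b 2, (o : E3)⟫])
      = volume.withDensity fun p => ENNReal.ofReal (circFunc (planeSq p)) := by
  ext A hA
  rw [Measure.map_apply (measurable_planeCoords b) hA, uniformSphere, Measure.smul_apply,
    Measure.toSphere_apply' _ (measurable_planeCoords b hA), volume_cone_eq_volume_ballCone b hA,
    volume_ballCone hA, withDensity_apply _ hA, Measure.toSphere_apply_univ,
    EuclideanSpace.volume_ball_fin_three]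
  have hc : ∀ p, ENNReal.ofReal (circFunc (planeSq p))
      = ENNReal.ofReal (1 / (2 * Real.pi)) * ENNReal.ofReal (1 / √(1 - planeSq p)) := by
    intro p
    rw [circFunc_of_nonneg (planeSq_nonneg p), ← ENNReal.ofReal_mul (by positivity)]
    congr 1
    rw [div_mul_div_comm, one_mul]
  simp_rw [hc]
  rw [lintegral_const_mul' _ _ (by simp), smul_eq_mul, ← mul_assoc, ← mul_assoc]
  congr 1
  simp only [finrank_euclideanSpace, Fintype.card_fin, Nat.cast_ofNat, ENNReal.ofReal_one, one_pow,
    one_mul]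
  rw [show (3 : ENNReal) = ENNReal.ofReal 3 by simp, ← ENNReal.ofReal_mul (by positivity),
    ← ENNReal.ofReal_inv_of_pos (by positivity), ← ENNReal.ofReal_mul (by positivity),
    ← ENNReal.ofReal_mul (by positivity)]
  congr 1
  field_simp
  norm_num

instance : IsProbabilityMeasure uniformSphere := by
  constructor
  rw [uniformSphere, Measure.smul_apply, smul_eq_mul, ENNReal.inv_mul_cancel]
  · simpa only [ne_eq, Measure.measure_univ_eq_zero] using Measure.toSphere_ne_zero _
  · exact measure_ne_top _ _

/-! ### Projection to an axis: Archimedes' theorem -/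

lemma lintegral_circ_slice (x : ℝ) :
    ∫⁻ y, ENNReal.ofReal (circFunc (x ^ 2 + y ^ 2))
      = (Ioo (-1 : ℝ) 1).indicator (fun _ => ENNReal.ofReal (1 / 2)) x := by
  have hc : ∀ y : ℝ, circFunc (x ^ 2 + y ^ 2) = 1 / (2 * Real.pi * √(1 - x ^ 2 - y ^ 2)) := by
    intro y
    rw [circFunc_of_nonneg (by positivity), sub_sub]
  simp_rw [hc]
  by_cases hx : x ∈ Ioo (-1 : ℝ) 1
  · rw [indicator_of_mem hx]
    have ha : 0 < 1 - x ^ 2 := by nlinarith [hx.1, hx.2]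
    set a := √(1 - x ^ 2) with hadef
    have ha0 : 0 < a := Real.sqrt_pos.2 ha
    have ha2 : 1 - x ^ 2 = a ^ 2 := (Real.sq_sqrt ha.le).symm
    rw [ha2]
    -- Under `y = a sin θ` the integrand becomes the constant `1 / (2π)` on an interval of length
    -- `π`, whence the value `1/2` for every `x`.
    have himg : (fun θ => a * Real.sin θ) '' Ioo (-(Real.pi / 2)) (Real.pi / 2) = Ioo (-a) a := by
      ext y
      constructor
      · rintro ⟨θ, hθ, rfl⟩
        have h1 := Real.cos_pos_of_mem_Ioo hθ
        have h2 := Real.sin_sq_add_cos_sq θ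
        constructor <;> nlinarith [sq_pos_of_pos h1, abs_lt.1 (abs_lt_of_sq_lt_sq
          (show Real.sin θ ^ 2 < 1 ^ 2 by nlinarith) zero_le_one)]
      · intro hy
        have h1 : -1 < y / a := by rw [lt_div_iff₀ ha0]; linarith [hy.1]
        have h2 : y / a < 1 := by rw [div_lt_iff₀ ha0]; linarith [hy.2]
        refine ⟨Real.arcsin (y / a), ⟨Real.neg_pi_div_two_lt_arcsin.2 h1,
          Real.arcsin_lt_pi_div_two.2 h2⟩, ?_⟩
        simp only
        rw [Real.sin_arcsin h1.le h2.le, mul_div_cancel₀ _ ha0.ne']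
    have key := lintegral_image_eq_lintegral_abs_deriv_mul
      (s := Ioo (-(Real.pi / 2)) (Real.pi / 2)) (f := fun θ => a * Real.sin θ)
      (f' := fun θ => a * Real.cos θ) measurableSet_Ioo
      (fun θ _ => ((Real.hasDerivAt_sin θ).const_mul a).hasDerivWithinAt)
      (fun s hs t ht hst => Real.injOn_sin (Ioo_subset_Icc_self hs) (Ioo_subset_Icc_self ht)
        (mul_left_cancel₀ ha0.ne' hst))
      (fun y => ENNReal.ofReal (1 / (2 * Real.pi * √(a ^ 2 - y ^ 2))))
    rw [himg] at key
    have hsupp : ∫⁻ y, ENNReal.ofReal (1 / (2 * Real.pi * √(a ^ 2 - y ^ 2)))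
        = ∫⁻ y in Ioo (-a) a, ENNReal.ofReal (1 / (2 * Real.pi * √(a ^ 2 - y ^ 2))) := by
      refine (setLIntegral_eq_of_support_subset fun y hy => ?_).symm
      by_contra hya
      apply hy
      have : a ^ 2 - y ^ 2 ≤ 0 := by
        by_contra! hlt
        exact hya (abs_lt.1 (abs_lt_of_sq_lt_sq (by linarith) ha0.le))
      simp [Real.sqrt_eq_zero_of_nonpos this]
    rw [hsupp, key]
    have hint : ∀ θ ∈ Ioo (-(Real.pi / 2)) (Real.pi / 2),
        ENNReal.ofReal |a * Real.cos θ|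
          * ENNReal.ofReal (1 / (2 * Real.pi * √(a ^ 2 - (a * Real.sin θ) ^ 2)))
        = ENNReal.ofReal (1 / (2 * Real.pi)) := by
      intro θ hθ
      have h1 := Real.cos_pos_of_mem_Ioo hθ
      have h2 : a ^ 2 - (a * Real.sin θ) ^ 2 = (a * Real.cos θ) ^ 2 := by
        have := Real.sin_sq_add_cos_sq θ
        linear_combination (-a ^ 2) * this
      rw [h2, Real.sqrt_sq (by positivity), ← ENNReal.ofReal_mul (abs_nonneg _),
        abs_of_pos (by positivity)]
      congr 1
      field_simp
    rw [setLIntegral_congr_fun measurableSet_Ioo hint, setLIntegral_const, Real.volume_Ioo,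
      ← ENNReal.ofReal_mul (by positivity)]
    congr 1
    field_simp
    ring
  · rw [indicator_of_notMem hx]
    have hx2 : 1 ≤ x ^ 2 := by
      by_contra! h
      exact hx (abs_lt.1 (abs_lt_of_sq_lt_sq (by linarith) zero_le_one))
    have : ∀ y : ℝ, 1 - x ^ 2 - y ^ 2 ≤ 0 := fun y => by nlinarith [sq_nonneg y]
    simp [Real.sqrt_eq_zero_of_nonpos (this _)]

lemma exists_orthonormalBasis_of_orthonormal_pair {e f : E3} (he : ‖e‖ = 1) (hf : ‖f‖ = 1)
    (hef : ⟪e, f⟫ = 0) : ∃ b : OrthonormalBasis (Fin 3) ℝ E3, b 1 = e ∧ b 2 = f := by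
  have hv : Orthonormal ℝ (({1, 2} : Set (Fin 3)).domRestrict ![0, e, f]) := by
    rw [orthonormal_iff_ite]
    rintro ⟨i, hi⟩ ⟨j, hj⟩
    rcases hi with rfl | rfl <;> rcases hj with rfl | rfl <;>
      simp [domRestrict, he, hf, hef, real_inner_comm, Subtype.ext_iff]
  obtain ⟨b, hb⟩ := hv.exists_orthonormalBasis_extension_of_card_eq (by simp)
  exact ⟨b, by simpa using hb 1 (by simp), by simpa using hb 2 (by simp)⟩

lemma exists_orthonormalBasis_of_norm_eq_one {e : E3} (he : ‖e‖ = 1) :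
    ∃ b : OrthonormalBasis (Fin 3) ℝ E3, b 1 = e := by
  have hv : Orthonormal ℝ (({1} : Set (Fin 3)).domRestrict ![0, e, 0]) := by
    rw [orthonormal_iff_ite]
    rintro ⟨i, hi⟩ ⟨j, hj⟩
    rcases hi with rfl
    rcases hj with rfl
    simp [domRestrict, he]
  obtain ⟨b, hb⟩ := hv.exists_orthonormalBasis_extension_of_card_eq (by simp)
  exact ⟨b, by simpa using hb 1 (by simp)⟩

/-- Archimedes' hat-box theorem: the projection of the uniform distribution on the sphere to an
axis is uniform on `[-1, 1]`. -/
theorem map_uniformSphere_inner {u : E3} (hu : ‖u‖ = 1) :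
    uniformSphere.map (fun o : S2 => ⟪u, (o : E3)⟫) = cond volume (Icc (-1 : ℝ) 1) := by
  obtain ⟨b, rfl⟩ := exists_orthonormalBasis_of_norm_eq_one hu
  have hcomp : (fun o : S2 => ⟪b 1, (o : E3)⟫)
      = (fun p : Fin 2 → ℝ => p 0) ∘ fun o : S2 => ![⟪b 1, (o : E3)⟫, ⟪b 2, (o : E3)⟫] := by
    ext o
    simp
  rw [hcomp, ← Measure.map_map (measurable_pi_apply 0) (measurable_planeCoords b),
    map_uniformSphere_planeCoords]
  have hcm := measurable_circFunc
  ext A hA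
  rw [Measure.map_apply (measurable_pi_apply 0) hA,
    withDensity_apply _ (measurable_pi_apply 0 hA)]
  have h2 := (volume_preserving_finTwoArrow ℝ).setLIntegral_comp_preimage_emb
    (MeasurableEquiv.finTwoArrow (α := ℝ)).measurableEmbedding
    (fun y : ℝ × ℝ => ENNReal.ofReal (circFunc (y.1 ^ 2 + y.2 ^ 2))) (A ×ˢ univ)
  have h3 : MeasurableEquiv.finTwoArrow (α := ℝ) ⁻¹' (A ×ˢ univ) = (fun p : Fin 2 → ℝ => p 0) ⁻¹' A := by
    ext p
    simp [MeasurableEquiv.finTwoArrow]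
  rw [h3] at h2
  have h4 : ∫⁻ p in (fun p : Fin 2 → ℝ => p 0) ⁻¹' A, ENNReal.ofReal (circFunc (planeSq p))
      = ∫⁻ y in A ×ˢ univ, ENNReal.ofReal (circFunc (y.1 ^ 2 + y.2 ^ 2))
        ∂(volume : Measure (ℝ × ℝ)) := h2
  rw [h4, Measure.volume_eq_prod, setLIntegral_prod _ (by fun_prop)]
  simp only [Measure.restrict_univ, lintegral_circ_slice]
  rw [setLIntegral_indicator measurableSet_Ioo, setLIntegral_const, cond_apply measurableSet_Icc,
    Real.volume_Icc, measure_congr ((Ioo_ae_eq_Icc (a := (-1 : ℝ)) (b := 1)).inter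
      (Filter.EventuallyEq.refl _ A)), ← ENNReal.ofReal_inv_of_pos (by norm_num)]
  norm_num

/-! ### Joint law of two inner products with a uniform unit vector -/

/-- The density at `z` of the law of `(⟪o, a⟫, ⟪o, b⟫)` for `o` uniform on the sphere, in terms of
`R = ‖a‖`, `I = ‖b‖` and the cosine `ρ` of the angle between `a` and `b`. -/
def ellipticDensity (R I ρ : ℝ) (z : ℂ) : ℝ :=
  1 / (R * I * √(1 - ρ ^ 2)) *
    circFunc ((z.re / R) ^ 2 + ((z.im / I - ρ * (z.re / R)) / √(1 - ρ ^ 2)) ^ 2)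

lemma circFunc_nonneg (x : ℝ) : 0 ≤ circFunc x := by
  unfold circFunc
  exact indicator_nonneg (fun y _ => by positivity) x

lemma ellipticDensity_nonneg {R I : ℝ} (hR : 0 ≤ R) (hI : 0 ≤ I) (ρ : ℝ) (z : ℂ) :
    0 ≤ ellipticDensity R I ρ z :=
  mul_nonneg (by positivity) (circFunc_nonneg _)

lemma pdfGivenField_eq_ellipticDensity (v : Fin 3 → ℂ) (z : ℂ) :
    pdfGivenField v z = ellipticDensity ‖reVec v‖ ‖imVec v‖ (corr v) z := by
  unfold pdfGivenField ellipticDensity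
  -- In the degenerate case both prefactors are `1 / 0 = 0`, so the singular matrix is irrelevant.
  by_cases hs : √(1 - corr v ^ 2) = 0
  · simp [hs]
  · congr 2
    rw [EuclideanSpace.norm_sq_eq]
    simp only [Fin.sum_univ_two, Real.norm_eq_abs, sq_abs, Matrix.inv_def, Matrix.adjugate_fin_two_of,
      Matrix.det_fin_two_of]
    simp [Matrix.mulVec, dotProduct, Fin.sum_univ_two, Ring.inverse_eq_inv']
    field_simp
    ring

lemma map_withDensity_linear_plane {M : Matrix (Fin 2) (Fin 2) ℝ} (hM : M.det ≠ 0)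
    {g : ℂ → ENNReal} (hg : Measurable g) :
    ((volume : Measure (Fin 2 → ℝ)).withDensity fun p => ENNReal.ofReal |M.det| *
        g (Complex.measurableEquivPi.symm (Matrix.toLin' M p))).map
      (fun p => Complex.measurableEquivPi.symm (Matrix.toLin' M p)) = volume.withDensity g := by
  have hL : Measurable (Matrix.toLin' M) := (LinearMap.continuous_on_pi _).measurable
  have hT : Measurable fun p : Fin 2 → ℝ => Complex.measurableEquivPi.symm (Matrix.toLin' M p) :=
    Complex.measurableEquivPi.symm.measurable.comp hL
  have hvol : (volume : Measure (Fin 2 → ℝ)).map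
      (fun p => Complex.measurableEquivPi.symm (Matrix.toLin' M p))
      = ENNReal.ofReal |M.det|⁻¹ • volume := by
    have h1 := Measure.map_map (μ := (volume : Measure (Fin 2 → ℝ)))
      Complex.measurableEquivPi.symm.measurable hL
    rw [Function.comp_def] at h1
    rw [← h1, Real.map_matrix_volume_pi_eq_smul_volume_pi hM, Measure.map_smul,
      (Complex.volume_preserving_equiv_pi.symm _).map_eq, abs_inv]
  ext A hA
  rw [Measure.map_apply hT hA, withDensity_apply _ (hT hA), withDensity_apply _ hA,
    lintegral_const_mul' _ _ ENNReal.ofReal_ne_top, ← setLIntegral_map hA hg hT, hvol,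
    Measure.restrict_smul, lintegral_smul_measure, smul_eq_mul, ← mul_assoc,
    ← ENNReal.ofReal_mul (abs_nonneg _), mul_inv_cancel₀ (abs_ne_zero.2 hM), ENNReal.ofReal_one,
    one_mul]

lemma measurable_ellipticDensity (R I ρ : ℝ) : Measurable (ellipticDensity R I ρ) := by
  have := measurable_circFunc
  have h1 := Complex.measurable_re
  have h2 := Complex.measurable_im
  unfold ellipticDensity
  fun_prop

/-- Gram-Schmidt gives orthonormal `e`, `f` with `a = R e` and `b = I (ρ e + s f)`, where `s = √(1 -
ρ²)`. The pair is therefore a lower triangular matrix of determinant `R I s` applied to the plane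
coordinates of `o`. -/
theorem map_uniformSphere_pair {a b : E3} {ρ : ℝ} (ha : a ≠ 0) (hb : b ≠ 0)
    (hρ : ⟪a, b⟫ = ρ * (‖a‖ * ‖b‖)) (hρ1 : ρ ^ 2 < 1) :
    uniformSphere.map (fun o : S2 => (⟨⟪(o : E3), a⟫, ⟪(o : E3), b⟫⟩ : ℂ))
      = volume.withDensity fun z => ENNReal.ofReal (ellipticDensity ‖a‖ ‖b‖ ρ z) := by
  have hR : 0 < ‖a‖ := norm_pos_iff.2 ha
  have hI : 0 < ‖b‖ := norm_pos_iff.2 hb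
  set R := ‖a‖ with hRdef
  set I := ‖b‖ with hIdef
  have hs2 : 0 < 1 - ρ ^ 2 := by linarith
  set s := √(1 - ρ ^ 2) with hsdef
  have hs : 0 < s := Real.sqrt_pos.2 hs2
  have hss : s ^ 2 = 1 - ρ ^ 2 := Real.sq_sqrt hs2.le
  have haa : ⟪a, a⟫ = R ^ 2 := real_inner_self_eq_norm_sq a
  have hbb : ⟪b, b⟫ = I ^ 2 := real_inner_self_eq_norm_sq b
  have hba : ⟪b, a⟫ = ρ * (R * I) := by rw [real_inner_comm, hρ]
  set e : E3 := R⁻¹ • a with he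
  set f : E3 := s⁻¹ • (I⁻¹ • b - (ρ * R⁻¹) • a) with hf
  have he1 : ‖e‖ = 1 := by
    rw [he, norm_smul, norm_inv, Real.norm_of_nonneg hR.le, inv_mul_cancel₀ hR.ne']
  have hf1 : ‖f‖ = 1 := by
    rw [← sq_eq_sq₀ (norm_nonneg f) zero_le_one, ← real_inner_self_eq_norm_sq]
    simp only [hf, inner_smul_left, inner_smul_right, inner_sub_left, inner_sub_right, haa, hbb,
      hρ, hba, RCLike.conj_to_real]
    field_simp
    linarith
  have hef : ⟪e, f⟫ = 0 := by
    simp only [he, hf, inner_smul_left, inner_smul_right, inner_sub_right, haa,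
      hρ, RCLike.conj_to_real]
    field_simp
    ring
  obtain ⟨β, hβ1, hβ2⟩ := exists_orthonormalBasis_of_orthonormal_pair he1 hf1 hef
  set M : Matrix (Fin 2) (Fin 2) ℝ := !![R, 0; I * ρ, I * s] with hMdef
  have hdet : M.det = R * I * s := by simp [hMdef, Matrix.det_fin_two_of, mul_assoc]
  have hdet0 : M.det ≠ 0 := by rw [hdet]; positivity
  have hT : ∀ p, Complex.measurableEquivPi.symm (Matrix.toLin' M p)
      = ⟨R * p 0, I * ρ * p 0 + I * s * p 1⟩ := by
    intro p
    rw [Complex.measurableEquivPi_symm_apply]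
    apply Complex.ext <;>
      simp [hMdef, Matrix.toLin'_apply, Matrix.mulVec, dotProduct, Fin.sum_univ_two]
  have hLm : Measurable fun p : Fin 2 → ℝ => Complex.measurableEquivPi.symm (Matrix.toLin' M p) :=
    Complex.measurableEquivPi.symm.measurable.comp (LinearMap.continuous_on_pi _).measurable
  have hcomp : (fun o : S2 => (⟨⟪(o : E3), a⟫, ⟪(o : E3), b⟫⟩ : ℂ))
      = (fun p : Fin 2 → ℝ => Complex.measurableEquivPi.symm (Matrix.toLin' M p)) ∘
        fun o : S2 => ![⟪β 1, (o : E3)⟫, ⟪β 2, (o : E3)⟫] := by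
    ext o
    simp only [Function.comp_apply, hT, hβ1, hβ2, he, hf]
    apply Complex.ext <;>
      simp [inner_smul_right, inner_sub_right, real_inner_comm (o : E3)] <;> field_simp
    ring
  rw [hcomp, ← Measure.map_map hLm (measurable_planeCoords β), map_uniformSphere_planeCoords,
    ← map_withDensity_linear_plane hdet0 (measurable_ellipticDensity R I ρ).ennreal_ofReal]
  congr 2
  ext p
  rw [← ENNReal.ofReal_mul (abs_nonneg _), hT, hdet, abs_of_pos (by positivity), ellipticDensity,
    ← hsdef]
  congr 1
  have h1 : R * p 0 / R = p 0 := by field_simp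
  have h2 : ((I * ρ * p 0 + I * s * p 1) / I - ρ * p 0) / s = p 1 := by field_simp; ring
  simp only [h1, h2, planeSq]
  field_simp

/-! ### The field vector and its Gram matrix -/

/-- The coefficient of `⟪u, o⟫ • u` in the field vector. -/
def axisCoeff (α : ℂ) (k r : ℝ) : ℂ :=
  α * (3 / 2 * (1 / ((k * r : ℝ) : ℂ) ^ 3 + Complex.I / ((k * r : ℝ) : ℂ) ^ 2)
    - 1 / (2 * ((k * r : ℝ) : ℂ)))

/-- The coefficient of the orientation `o` in the field vector. -/
def orientCoeff (α : ℂ) (k r : ℝ) : ℂ :=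
  α * (1 / (2 * ((k * r : ℝ) : ℂ))
    - 1 / 2 * (1 / ((k * r : ℝ) : ℂ) ^ 3 + Complex.I / ((k * r : ℝ) : ℂ) ^ 2))

lemma fieldVector_eq (α : ℂ) (k r : ℝ) (u o : E3) (i : Fin 3) :
    fieldVector α k r u o i
      = axisCoeff α k r * ((⟪u, o⟫ * u i : ℝ) : ℂ) + orientCoeff α k r * ((o i : ℝ) : ℂ) := by
  simp only [fieldVector, axisCoeff, orientCoeff, nearField, farField, PiLp.smul_apply,
    PiLp.sub_apply, smul_eq_mul]
  push_cast
  ring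

lemma channelCoeff_eq (α : ℂ) (k r : ℝ) (u oT oR : E3) :
    channelCoeff α k r u oT oR
      = axisCoeff α k r * ((⟪u, oT⟫ * ⟪oR, u⟫ : ℝ) : ℂ)
        + orientCoeff α k r * ((⟪oR, oT⟫ : ℝ) : ℂ) := by
  simp only [channelCoeff, axisCoeff, orientCoeff, nearAlign, farAlign, nearField, farField,
    inner_smul_right, inner_sub_right]
  push_cast
  ring

lemma reVec_fieldVector (α : ℂ) (k r : ℝ) (u o : E3) :
    reVec (fieldVector α k r u o)
      = ((axisCoeff α k r).re * ⟪u, o⟫) • u + (orientCoeff α k r).re • o := by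
  ext i
  simp only [reVec, fieldVector_eq, Complex.add_re, Complex.re_mul_ofReal, PiLp.add_apply,
    PiLp.smul_apply, smul_eq_mul]
  ring

lemma imVec_fieldVector (α : ℂ) (k r : ℝ) (u o : E3) :
    imVec (fieldVector α k r u o)
      = ((axisCoeff α k r).im * ⟪u, o⟫) • u + (orientCoeff α k r).im • o := by
  ext i
  simp only [imVec, fieldVector_eq, Complex.add_im, Complex.im_mul_ofReal, PiLp.add_apply,
    PiLp.smul_apply, smul_eq_mul]
  ring

lemma channelCoeff_eq_inner (α : ℂ) (k r : ℝ) (u oT oR : E3) :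
    channelCoeff α k r u oT oR
      = ⟨⟪oR, reVec (fieldVector α k r u oT)⟫, ⟪oR, imVec (fieldVector α k r u oT)⟫⟩ := by
  rw [channelCoeff_eq, reVec_fieldVector, imVec_fieldVector]
  apply Complex.ext
  · simp only [Complex.add_re, Complex.re_mul_ofReal, inner_add_right, inner_smul_right]
    ring
  · simp only [Complex.add_im, Complex.im_mul_ofReal, inner_add_right, inner_smul_right]
    ring

/-- The inner product of `(p * x) • u + q • o` and `(p' * x) • u + q' • o` for unit vectors `u`,
`o` with `⟪u, o⟫ = x`. -/
def gramEntry (p q p' q' x : ℝ) : ℝ := (p * p' + p * q' + q * p') * x ^ 2 + q * q'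

lemma inner_eq_gramEntry {u o : E3} (hu : ‖u‖ = 1) (ho : ‖o‖ = 1) (p q p' q' : ℝ) :
    ⟪(p * ⟪u, o⟫) • u + q • o, (p' * ⟪u, o⟫) • u + q' • o⟫ = gramEntry p q p' q' ⟪u, o⟫ := by
  simp only [inner_add_left, inner_add_right, inner_smul_left, inner_smul_right,
    real_inner_self_eq_norm_sq, hu, ho, RCLike.conj_to_real, real_inner_comm u o, gramEntry]
  ring

/-- The density of the channel coefficient given that the projection `⟪u, o⟫` equals `x`. -/
def projDensity (A B : ℂ) (x : ℝ) (z : ℂ) : ℝ :=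
  ellipticDensity (√(gramEntry A.re B.re A.re B.re x)) (√(gramEntry A.im B.im A.im B.im x))
    (gramEntry A.re B.re A.im B.im x
      / (√(gramEntry A.re B.re A.re B.re x) * √(gramEntry A.im B.im A.im B.im x))) z

lemma projDensity_nonneg (A B : ℂ) (x : ℝ) (z : ℂ) : 0 ≤ projDensity A B x z :=
  ellipticDensity_nonneg (Real.sqrt_nonneg _) (Real.sqrt_nonneg _) _ _

lemma measurable_projDensity (A B : ℂ) :
    Measurable fun y : ℝ × ℂ => projDensity A B y.1 y.2 := by
  have := measurable_circFunc
  have h1 := Complex.measurable_re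
  have h2 := Complex.measurable_im
  unfold projDensity ellipticDensity gramEntry
  fun_prop

/-- The density sees `v` only through the norms of `Re v`, `Im v` and their inner product, all of
which are polynomials in `⟪u, o⟫` or square roots of such. -/
lemma pdfGivenField_fieldVector (α : ℂ) (k r : ℝ) {u o : E3} (hu : ‖u‖ = 1) (ho : ‖o‖ = 1)
    (z : ℂ) :
    pdfGivenField (fieldVector α k r u o) z
      = projDensity (axisCoeff α k r) (orientCoeff α k r) ⟪u, o⟫ z := by
  have hn : ∀ x : E3, ‖x‖ = √⟪x, x⟫ := fun x => by
    rw [real_inner_self_eq_norm_sq, Real.sqrt_sq (norm_nonneg x)]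
  rw [pdfGivenField_eq_ellipticDensity, corr, hn (reVec _), hn (imVec _), reVec_fieldVector,
    imVec_fieldVector]
  simp only [inner_eq_gramEntry hu ho]
  rfl

lemma exists_norm_eq_one_inner_eq_zero {u : E3} (hu : ‖u‖ = 1) :
    ∃ w : E3, ‖w‖ = 1 ∧ ⟪u, w⟫ = 0 := by
  obtain ⟨b, rfl⟩ := exists_orthonormalBasis_of_norm_eq_one hu
  exact ⟨b 0, b.norm_eq_one 0, b.inner_eq_zero (by decide)⟩

/-- There is a measurable choice of a unit vector with prescribed projection to an axis. -/
lemma exists_measurable_section {u : E3} (hu : ‖u‖ = 1) :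
    ∃ s : ℝ → S2, Measurable s ∧ ∀ x ∈ Icc (-1 : ℝ) 1, ⟪u, (s x : E3)⟫ = x := by
  obtain ⟨w, hw, huw⟩ := exists_norm_eq_one_inner_eq_zero hu
  -- Clamping to `[-1, 1]` makes the section total and continuous on `ℝ`.
  set y : ℝ → ℝ := fun x => max (-1) (min 1 x) with hy
  have hy2 : ∀ x, 0 ≤ 1 - y x ^ 2 := fun x => by
    have h1 : -1 ≤ y x := le_max_left _ _
    have h2 : y x ≤ 1 := max_le (by norm_num) (min_le_left _ _)
    nlinarith
  have hmem : ∀ x, y x • u + √(1 - y x ^ 2) • w ∈ Metric.sphere (0 : E3) 1 := fun x => by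
    rw [mem_sphere_zero_iff_norm, ← sq_eq_sq₀ (norm_nonneg _) zero_le_one,
      ← real_inner_self_eq_norm_sq]
    simp only [inner_add_left, inner_add_right, inner_smul_left, inner_smul_right,
      real_inner_self_eq_norm_sq, hu, hw, RCLike.conj_to_real, real_inner_comm u w, huw]
    have := Real.sq_sqrt (hy2 x)
    linear_combination this
  refine ⟨fun x => ⟨_, hmem x⟩, ?_, ?_⟩
  · refine Continuous.measurable (Continuous.subtype_mk ?_ _)
    fun_prop
  · intro x hx
    have : y x = x := by simp [hy, hx.1, hx.2]
    simp only [this, inner_add_right, inner_smul_right, huw, real_inner_self_eq_norm_sq, hu]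
    ring

lemma pdfGivenProj_eq (α : ℂ) (k r : ℝ) {u : E3} (hu : ‖u‖ = 1) {x : ℝ}
    (hx : x ∈ Icc (-1 : ℝ) 1) (z : ℂ) :
    pdfGivenProj α k r u x z = projDensity (axisCoeff α k r) (orientCoeff α k r) x z := by
  obtain ⟨s, -, hs⟩ := exists_measurable_section hu
  have h : ‖someOrientation u x‖ = 1 ∧ ⟪u, someOrientation u x⟫ = x :=
    Classical.epsilon_spec (p := fun o : E3 => ‖o‖ = 1 ∧ ⟪u, o⟫ = x)
      ⟨s x, norm_eq_of_mem_sphere _, hs x hx⟩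
  rw [pdfGivenProj, pdfGivenField_fieldVector α k r hu h.1, h.2]

/-- The two coefficients are not real multiples of each other, thanks to the quadrature term
`j/(kr)²`: the determinant is `-|α|² / (2 (kr)³)`. -/
lemma coeff_det_ne_zero {α : ℂ} (hα : α ≠ 0) {k r : ℝ} (hk : 0 < k) (hr : 0 < r) :
    (axisCoeff α k r).re * (orientCoeff α k r).im
      - (axisCoeff α k r).im * (orientCoeff α k r).re ≠ 0 := by
  have hkr : 0 < k * r := mul_pos hk hr
  set t := k * r with ht
  have h1 : axisCoeff α k r = α * ((3 / 2 * (1 / t ^ 3) - 1 / (2 * t) : ℝ)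
      + (3 / 2 * (1 / t ^ 2) : ℝ) * Complex.I) := by
    rw [axisCoeff, ← ht]
    push_cast
    ring
  have h2 : orientCoeff α k r = α * ((1 / (2 * t) - 1 / 2 * (1 / t ^ 3) : ℝ)
      + (-(1 / 2 * (1 / t ^ 2)) : ℝ) * Complex.I) := by
    rw [orientCoeff, ← ht]
    push_cast
    ring
  have h3 : (axisCoeff α k r).re * (orientCoeff α k r).im
      - (axisCoeff α k r).im * (orientCoeff α k r).re
      = -(Complex.normSq α * (1 / (2 * t) * (1 / t ^ 2))) := by
    rw [h1, h2, Complex.normSq_apply]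
    simp only [Complex.mul_re, Complex.mul_im, Complex.add_re, Complex.add_im, Complex.ofReal_re,
      Complex.ofReal_im, Complex.I_re, Complex.I_im]
    ring
  rw [h3]
  have := Complex.normSq_pos.2 hα
  exact neg_ne_zero.2 (by positivity)

/-- Linear independence of `Re v` and `Im v` comes from their Gram determinant: the squared
coefficient determinant times `x² (1 - x²)`, the Gram determinant of `x u` and `o`. -/
theorem map_channelCoeff {α : ℂ} (hα : α ≠ 0) {k r : ℝ} (hk : 0 < k) (hr : 0 < r)
    {u o : E3} (hu : ‖u‖ = 1) (ho : ‖o‖ = 1) (h0 : ⟪u, o⟫ ≠ 0) (h1 : ⟪u, o⟫ ^ 2 < 1) :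
    uniformSphere.map (fun oR : S2 => channelCoeff α k r u o oR)
      = volume.withDensity fun z =>
        ENNReal.ofReal (pdfGivenField (fieldVector α k r u o) z) := by
  set a := reVec (fieldVector α k r u o) with ha
  set b := imVec (fieldVector α k r u o) with hb
  have hgram : 0 < ‖a‖ ^ 2 * ‖b‖ ^ 2 - ⟪a, b⟫ ^ 2 := by
    have hd := coeff_det_ne_zero hα hk hr
    set A := axisCoeff α k r with hA
    set B := orientCoeff α k r with hB
    have : ‖a‖ ^ 2 * ‖b‖ ^ 2 - ⟪a, b⟫ ^ 2
        = (A.re * B.im - A.im * B.re) ^ 2 * (⟪u, o⟫ ^ 2 * (1 - ⟪u, o⟫ ^ 2)) := by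
      rw [← real_inner_self_eq_norm_sq, ← real_inner_self_eq_norm_sq, ha, hb, reVec_fieldVector,
        imVec_fieldVector]
      simp only [inner_eq_gramEntry hu ho, gramEntry]
      ring
    rw [this]
    have h2 : 0 < 1 - ⟪u, o⟫ ^ 2 := by linarith
    positivity
  have ha0 : a ≠ 0 := by
    intro h
    simp [h] at hgram
  have hb0 : b ≠ 0 := by
    intro h
    simp [h] at hgram
  have hna := norm_pos_iff.2 ha0
  have hnb := norm_pos_iff.2 hb0
  have hcorr : corr (fieldVector α k r u o) = ⟪a, b⟫ / (‖a‖ * ‖b‖) := rfl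
  have hρ : ⟪a, b⟫ = corr (fieldVector α k r u o) * (‖a‖ * ‖b‖) := by
    rw [hcorr]
    field_simp
  have hρ1 : corr (fieldVector α k r u o) ^ 2 < 1 := by
    rw [hcorr, div_pow, div_lt_one (by positivity), mul_pow]
    linarith
  simp_rw [pdfGivenField_eq_ellipticDensity, channelCoeff_eq_inner]
  exact map_uniformSphere_pair ha0 hb0 hρ hρ1

/-! ### Conditional laws of a function of independent variables -/

section Conditioning

variable {Ω 𝓧 𝓨 𝓩 𝓦 : Type*} [MeasurableSpace Ω] [MeasurableSpace 𝓧] [MeasurableSpace 𝓨]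
  [MeasurableSpace 𝓩] [MeasurableSpace 𝓦]

/-- The kernel sending `x` to the law of `F (x, Y)` for `Y` with law `ν`. -/
def mapKernel (F : 𝓧 × 𝓨 → 𝓩) (ν : Measure 𝓨) : Kernel 𝓧 𝓩 :=
  (Kernel.id ×ₖ Kernel.const 𝓧 ν).map F

lemma isMarkovKernel_mapKernel {F : 𝓧 × 𝓨 → 𝓩} (hF : Measurable F) (ν : Measure 𝓨)
    [IsProbabilityMeasure ν] : IsMarkovKernel (mapKernel F ν) :=
  Kernel.IsMarkovKernel.map _ hF

lemma mapKernel_apply {F : 𝓧 × 𝓨 → 𝓩} (hF : Measurable F) (ν : Measure 𝓨) [SFinite ν] (x : 𝓧) :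
    mapKernel F ν x = ν.map fun y => F (x, y) := by
  rw [mapKernel, Kernel.map_apply _ hF, Kernel.prod_apply, Kernel.id_apply, Kernel.const_apply,
    Measure.dirac_prod, Measure.map_map hF (by fun_prop)]
  rfl

/-- Freezing principle: by independence the joint law of `X` and `Y` is a product, so conditionally
on `X = x` the value is distributed as `F (x, Y)`. -/
lemma map_prodMk_eq_compProd_mapKernel {P : Measure Ω} [IsFiniteMeasure P] {X : Ω → 𝓧} {Y : Ω → 𝓨}
    (hX : AEMeasurable X P) (hY : AEMeasurable Y P) (hXY : IndepFun X Y P) {F : 𝓧 × 𝓨 → 𝓩}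
    (hF : Measurable F) (ν : Measure 𝓨) [IsProbabilityMeasure ν] (hν : P.map Y = ν) :
    P.map (fun ω => (X ω, F (X ω, Y ω))) = P.map X ⊗ₘ mapKernel F ν := by
  have := isMarkovKernel_mapKernel hF ν
  have h1 : P.map (fun ω => (X ω, Y ω)) = (P.map X).prod ν := by
    rw [(indepFun_iff_map_prod_eq_prod_map_map hX hY).1 hXY, hν]
  have h2 : P.map (fun ω => (X ω, F (X ω, Y ω)))
      = (P.map fun ω => (X ω, Y ω)).map fun y => (y.1, F y) := by
    rw [AEMeasurable.map_map_of_aemeasurable (by fun_prop) (by fun_prop)]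
    rfl
  rw [h2, h1]
  ext A hA
  have hm : Measurable fun y : 𝓧 × 𝓨 => (y.1, F y) := by fun_prop
  rw [Measure.map_apply hm hA, Measure.prod_apply (hm hA), Measure.compProd_apply hA]
  refine lintegral_congr fun x => ?_
  rw [mapKernel_apply hF, Measure.map_apply (by fun_prop) (measurable_prodMk_left hA)]
  rfl

/-- Allows conditioning on the coarser variable `f x` when the conditional law depends on `x` only
through it. -/
lemma map_compProd_of_factor {μ : Measure 𝓧} [SFinite μ] {κ : Kernel 𝓧 𝓩} [IsSFiniteKernel κ]
    {η : Kernel 𝓦 𝓩} [IsSFiniteKernel η] {f : 𝓧 → 𝓦} (hf : Measurable f)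
    (h : ∀ᵐ x ∂μ, κ x = η (f x)) :
    (μ ⊗ₘ κ).map (Prod.map f id) = μ.map f ⊗ₘ η := by
  ext A hA
  rw [Measure.map_apply (hf.prodMap measurable_id) hA,
    Measure.compProd_apply (hf.prodMap measurable_id hA), Measure.compProd_apply hA,
    lintegral_map (Kernel.measurable_kernel_prodMk_left hA) hf]
  refine lintegral_congr_ae ?_
  filter_upwards [h] with x hx
  rw [hx]
  rfl

lemma map_eq_withDensity_of_mixture {μ : Measure 𝓧} [SFinite μ] {κ : Kernel 𝓧 𝓩}
    [IsSFiniteKernel κ] {lam : Measure 𝓩} [SFinite lam] {g : 𝓧 → 𝓩 → ENNReal}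
    (hg : Measurable (Function.uncurry g))
    (h : ∀ᵐ x ∂μ, κ x = lam.withDensity (g x)) :
    (μ ⊗ₘ κ).snd = lam.withDensity fun z => ∫⁻ x, g x z ∂μ := by
  ext A hA
  rw [Measure.snd_apply hA, Measure.compProd_apply (measurable_snd hA), withDensity_apply _ hA,
    lintegral_lintegral_swap (f := fun z x => g x z) (hg.comp measurable_swap).aemeasurable]
  refine lintegral_congr_ae ?_
  filter_upwards [h] with x hx
  rw [hx, ← withDensity_apply _ hA]
  rfl

end Conditioning

/-! ### Null sets and measurability -/

lemma ae_cond_Icc : ae (cond volume (Icc (-1 : ℝ) 1)) = ae (volume.restrict (Icc (-1 : ℝ) 1)) := by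
  rw [ProbabilityTheory.cond, Real.volume_Icc]
  exact Measure.ae_ennreal_smul_measure_eq (by simp) _

lemma ae_restrict_Icc_nondegenerate :
    ∀ᵐ x ∂(volume.restrict (Icc (-1 : ℝ) 1)), x ∈ Icc (-1 : ℝ) 1 ∧ x ≠ 0 ∧ x ^ 2 < 1 := by
  rw [ae_restrict_iff' measurableSet_Icc]
  have h : ∀ c : ℝ, ∀ᵐ x : ℝ, x ≠ c := fun c => by simp [ae_iff]
  filter_upwards [h 0, h 1, h (-1)] with x h0 h1 h2 hx
  refine ⟨hx, h0, ?_⟩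
  rw [sq_lt_one_iff_abs_lt_one, abs_lt]
  exact ⟨lt_of_le_of_ne hx.1 (Ne.symm h2), lt_of_le_of_ne hx.2 h1⟩

lemma ae_uniformSphere_nondegenerate {u : E3} (hu : ‖u‖ = 1) :
    ∀ᵐ o : S2 ∂uniformSphere, ⟪u, (o : E3)⟫ ≠ 0 ∧ ⟪u, (o : E3)⟫ ^ 2 < 1 := by
  have hm : Measurable fun o : S2 => ⟪u, (o : E3)⟫ := Continuous.measurable (by fun_prop)
  have h := ae_restrict_Icc_nondegenerate
  rw [← ae_cond_Icc, ← map_uniformSphere_inner hu] at h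
  filter_upwards [ae_of_ae_map hm.aemeasurable h] with o ho using ho.2

lemma continuous_channelCoeff (α : ℂ) (k r : ℝ) (u : E3) :
    Continuous fun y : S2 × S2 => channelCoeff α k r u y.1 y.2 := by
  unfold channelCoeff nearAlign farAlign nearField farField
  fun_prop

end Dipole

end

/-! ### Assembly -/

theorem proposition5 {Ω : Type*} [MeasurableSpace Ω] (P : Measure Ω) [IsProbabilityMeasure P]
    (α : ℂ) (hα : α ≠ 0) (k r : ℝ) (hk : 0 < k) (hr : 0 < r)
    (u : Dipole.E3) (hu : ‖u‖ = 1)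
    (oT oR : Ω → Dipole.S2)
    (hoT : HasLaw oT Dipole.uniformSphere P) (hoR : HasLaw oR Dipole.uniformSphere P)
    (hind : IndepFun oT oR P)
    (h : Ω → ℂ) (hh : ∀ ω, h ω = Dipole.channelCoeff α k r u (oT ω) (oR ω)) :
    -- the projection `uᵀ o_TX` is uniform on `[-1,1]`
    pdf.IsUniform (fun ω => inner ℝ u (oT ω : Dipole.E3)) (Icc (-1 : ℝ) 1) P ∧
    -- `f(z | v)` depends on the transmit orientation only through `uᵀ o_TX`
    (∀ (o : Dipole.S2) (z : ℂ),
      Dipole.pdfGivenField (Dipole.fieldVector α k r u o) z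
        = Dipole.pdfGivenProj α k r u (inner ℝ u (o : Dipole.E3)) z) ∧
    -- `f(· | v)` is the conditional density of `h` given `o_TX`
    (∀ᵐ o ∂Dipole.uniformSphere,
      condDistrib h oT P o = volume.withDensity (fun z =>
        ENNReal.ofReal (Dipole.pdfGivenField (Dipole.fieldVector α k r u o) z))) ∧
    -- `f(· | x)` is the conditional density of `h` given `uᵀ o_TX = x`
    (∀ᵐ x ∂(volume.restrict (Icc (-1 : ℝ) 1)),
      condDistrib h (fun ω => inner ℝ u (oT ω : Dipole.E3)) P x = volume.withDensity (fun z =>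
        ENNReal.ofReal (Dipole.pdfGivenProj α k r u x z))) ∧
    -- `h` has a density, and it is the average of the conditional densities
    HasPDF h P volume ∧
    (∀ᵐ z : ℂ, IntervalIntegrable (fun x => Dipole.pdfGivenProj α k r u x z) volume (-1) 1) ∧
    (pdf h P volume =ᵐ[volume] fun z =>
      ENNReal.ofReal ((1 / 2) * ∫ x in (-1 : ℝ)..1, Dipole.pdfGivenProj α k r u x z)) := by
  open Dipole in
  obtain ⟨F, hF, hFc⟩ : ∃ F : S2 × S2 → ℂ, Measurable F ∧
      ∀ y, F y = channelCoeff α k r u y.1 y.2 :=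
    ⟨_, (continuous_channelCoeff α k r u).measurable, fun _ => rfl⟩
  obtain rfl : h = fun ω => F (oT ω, oR ω) := funext fun ω => by rw [hh, hFc]
  clear hh
  let h : Ω → ℂ := fun ω => F (oT ω, oR ω)
  have hTm := hoT.aemeasurable
  have hRm := hoR.aemeasurable
  have hhm : AEMeasurable h P := hF.comp_aemeasurable (hTm.prodMk hRm)
  let proj : S2 → ℝ := fun o => ⟪u, (o : E3)⟫
  have hprojm : Measurable proj := Continuous.measurable (by fun_prop)
  have hXm : AEMeasurable (fun ω => proj (oT ω)) P := hprojm.comp_aemeasurable hTm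
  have hXlaw : P.map (fun ω => proj (oT ω)) = cond volume (Icc (-1 : ℝ) 1) := by
    rw [← map_uniformSphere_inner hu, ← hoT.map_eq,
      AEMeasurable.map_map_of_aemeasurable hprojm.aemeasurable hTm]
    rfl
  have hprojmem : ∀ o : S2, proj o ∈ Icc (-1 : ℝ) 1 := fun o => by
    have := abs_real_inner_le_norm u (o : E3)
    rw [hu, norm_eq_of_mem_sphere, mul_one] at this
    exact abs_le.1 this
  let D : ℝ → ℂ → ℝ := projDensity (axisCoeff α k r) (orientCoeff α k r)
  have hDm : Measurable fun y : ℝ × ℂ => D y.1 y.2 := measurable_projDensity _ _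
  have hfield : ∀ (o : S2) (z : ℂ), pdfGivenField (fieldVector α k r u o) z = D (proj o) z :=
    fun o z => pdfGivenField_fieldVector α k r hu (norm_eq_of_mem_sphere o) z
  have hprojD : ∀ x ∈ Icc (-1 : ℝ) 1, ∀ z, pdfGivenProj α k r u x z = D x z :=
    fun x hx z => pdfGivenProj_eq α k r hu hx z
  let κ : Kernel S2 ℂ := mapKernel F uniformSphere
  have hκM : IsMarkovKernel κ := isMarkovKernel_mapKernel hF _
  have hκD : ∀ o : S2, proj o ≠ 0 → proj o ^ 2 < 1 →
      κ o = volume.withDensity fun z => ENNReal.ofReal (D (proj o) z) := by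
    intro o h0 h1
    rw [mapKernel_apply hF]
    simp_rw [← hfield, hFc]
    exact map_channelCoeff hα hk hr hu (norm_eq_of_mem_sphere o) h0 h1
  have hjoint : P.map (fun ω => (oT ω, h ω)) = uniformSphere ⊗ₘ κ := by
    have := map_prodMk_eq_compProd_mapKernel hTm hRm hind hF uniformSphere hoR.map_eq
    rwa [hoT.map_eq] at this
  obtain ⟨s, hsm, hs⟩ := exists_measurable_section hu
  -- Pulling `κ` back along a measurable section yields a Markov kernel for every real `x`, whereas
  -- the densities have mass 1 only at nondegenerate `x`.
  let η : Kernel ℝ ℂ := κ.comap s hsm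
  have hηD : ∀ x ∈ Icc (-1 : ℝ) 1, x ≠ 0 → x ^ 2 < 1 →
      η x = volume.withDensity fun z => ENNReal.ofReal (D x z) := by
    intro x hx h0 h1
    have hsx : proj (s x) = x := hs x hx
    rw [Kernel.comap_apply, hκD (s x) (by rwa [hsx]) (by rwa [hsx]), hsx]
  have hκη : ∀ᵐ o ∂uniformSphere, κ o = η (proj o) := by
    filter_upwards [ae_uniformSphere_nondegenerate hu] with o ho
    rw [hκD o ho.1 ho.2, hηD _ (hprojmem o) ho.1 ho.2]
  have hjoint' : P.map (fun ω => (proj (oT ω), h ω))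
      = cond volume (Icc (-1 : ℝ) 1) ⊗ₘ η := by
    rw [← map_uniformSphere_inner hu, ← map_compProd_of_factor hprojm hκη, ← hjoint,
      AEMeasurable.map_map_of_aemeasurable (hprojm.prodMap measurable_id).aemeasurable
        (hTm.prodMk hhm)]
    rfl
  have hηae : ∀ᵐ x ∂(cond volume (Icc (-1 : ℝ) 1)),
      η x = volume.withDensity fun z => ENNReal.ofReal (D x z) := by
    rw [ae_cond_Icc]
    filter_upwards [ae_restrict_Icc_nondegenerate] with x hx
    exact hηD x hx.1 hx.2.1 hx.2.2
  have hprob : IsProbabilityMeasure (cond volume (Icc (-1 : ℝ) 1)) :=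
    hXlaw ▸ Measure.isProbabilityMeasure_map hXm
  have hlaw : P.map h = volume.withDensity
      fun z => ∫⁻ x, ENNReal.ofReal (D x z) ∂(cond volume (Icc (-1 : ℝ) 1)) := by
    rw [← map_eq_withDensity_of_mixture (g := fun x z => ENNReal.ofReal (D x z))
      hDm.ennreal_ofReal hηae, ← hjoint', Measure.snd_map_prodMk₀ hXm]
  have hdm : Measurable
      fun z => ∫⁻ x, ENNReal.ofReal (D x z) ∂(cond volume (Icc (-1 : ℝ) 1)) :=
    (hDm.ennreal_ofReal.comp measurable_swap).lintegral_prod_right'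
  -- The integral of this function over `z` is the total mass of the law of `h`, hence finite.
  have hfin : ∀ᵐ z : ℂ, ∫⁻ x, ENNReal.ofReal (D x z) ∂(cond volume (Icc (-1 : ℝ) 1)) < ⊤ := by
    refine ae_lt_top hdm ?_
    rw [← setLIntegral_univ, ← withDensity_apply _ MeasurableSet.univ, ← hlaw]
    have := Measure.isProbabilityMeasure_map hhm
    exact measure_ne_top _ _
  have hint : ∀ᵐ z : ℂ, Integrable (fun x => D x z) (volume.restrict (Icc (-1 : ℝ) 1)) := by
    filter_upwards [hfin] with z hz
    have hi : Integrable (fun x => D x z) (cond volume (Icc (-1 : ℝ) 1)) := by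
      refine ⟨(hDm.comp measurable_prodMk_right).aestronglyMeasurable, ?_⟩
      rw [hasFiniteIntegral_iff_ofReal (Filter.Eventually.of_forall fun x => projDensity_nonneg _ _ _ _)]
      exact hz
    rw [ProbabilityTheory.cond, Real.volume_Icc] at hi
    exact (integrable_smul_measure (by simp) (by norm_num)).1 hi
  have hii : ∀ z, Integrable (fun x => D x z) (volume.restrict (Icc (-1 : ℝ) 1)) →
      IntervalIntegrable (fun x => pdfGivenProj α k r u x z) volume (-1) 1 := by
    intro z hz
    rw [intervalIntegrable_iff_integrableOn_Icc_of_le (by norm_num)]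
    exact IntegrableOn.congr_fun hz (fun x hx => (hprojD x hx z).symm) measurableSet_Icc
  refine ⟨hXlaw, fun o z => ?_, ?_, ?_, ?_, ?_, ?_⟩
  · rw [hfield o z]
    exact (hprojD _ (hprojmem o) z).symm
  · have hc := condDistrib_ae_eq_of_measure_eq_compProd oT hhm (κ := κ) (by rw [hjoint, hoT.map_eq])
    rw [hoT.map_eq] at hc
    filter_upwards [hc, ae_uniformSphere_nondegenerate hu] with o ho ho'
    exact ho.trans ((hκD o ho'.1 ho'.2).trans (congrArg _ (funext fun z => by rw [hfield])))
  · have hc := condDistrib_ae_eq_of_measure_eq_compProd (fun ω => proj (oT ω)) hhm (κ := η)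
      (by rw [hjoint', hXlaw])
    rw [hXlaw, Filter.EventuallyEq, ae_cond_Icc] at hc
    filter_upwards [hc, ae_restrict_Icc_nondegenerate] with x hx hx'
    exact hx.trans ((hηD x hx'.1 hx'.2.1 hx'.2.2).trans
      (congrArg _ (funext fun z => by rw [hprojD x hx'.1 z])))
  · exact hasPDF_of_map_eq_withDensity hhm _ hdm.aemeasurable hlaw
  · filter_upwards [hint] with z hz using hii z hz
  · have hp : pdf h P volume =ᵐ[volume]
        fun z => ∫⁻ x, ENNReal.ofReal (D x z) ∂(cond volume (Icc (-1 : ℝ) 1)) := by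
      rw [pdf, hlaw]
      exact Measure.rnDeriv_withDensity _ hdm
    filter_upwards [hp, hint] with z hz hzi
    -- The factor `1/2` is the inverse length of `[-1, 1]`, the normalization in `cond`.
    rw [hz, intervalIntegral.integral_of_le (by norm_num), ← integral_Icc_eq_integral_Ioc,
      setIntegral_congr_fun measurableSet_Icc fun x hx => hprojD x hx z,
      ENNReal.ofReal_mul (by norm_num), ofReal_integral_eq_lintegral_ofReal hzi
        (Filter.Eventually.of_forall fun x => projDensity_nonneg _ _ _ _),
      ProbabilityTheory.cond,
      lintegral_smul_measure, Real.volume_Icc, ← ENNReal.ofReal_inv_of_pos (by norm_num)]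
    norm_num
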